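/- For every real number $\varepsilon > 0$ there are infinitely many positive integers $N$ such that $$\gcd(N, \sigma(N)) \ge N^{2/3-\varepsilon},$$ where $\sigma(N)=\sum_{d\mid N} d$ denotes the sum of the positive divisors of $N$. -/

import Mathlib

open ArithmeticFunction

/-! Take `N = p * a * σ(a)` with `p` prime, `a ∣ p + 1`, and `p`, `a`, `σ(a)` pairwise coprime. Then
`σ(N) = (p + 1) σ(a) σ(σ(a))` is divisible by `D = a σ(a) ≥ a ^ 2`. If `a ≥ p ^ (1 - η)`, then `D`
is at least about `p ^ 2`, while `N = p * D`, which gives the exponent `2/3`.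

For `a`, take the part of `p + 1` built from primes at least `Y = 1000 k ^ 3`, where `p ≤ X = 2 ^
k`. It can fail only if `p + 1` has a divisor `r ^ 2` with `r ≥ Y`, a divisor `r * q` with `r ≥ Y`,
`q` prime and `r ∣ q + 1`, or a large `Y`-smooth divisor. Each event is rare even among all integers
up to `2X`: the bounds are below `π(X) ≈ X / k`, so no sieve is needed
(`exists_prime_and_large_divisor`). -/

/-! ### Divisibility: the construction of `N` -/

/-- A prime dividing `σ a`, for squarefree `a`, divides `q + 1` for some prime factor `q` of `a`. -/
lemma exists_prime_dvd_add_one_of_dvd_sigma {a r : ℕ} (ha : Squarefree a) (hr : r.Prime)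
    (h : r ∣ sigma 1 a) : ∃ q, q.Prime ∧ q ∣ a ∧ r ∣ q + 1 := by
  have h1 : sigma 1 a = ∏ q ∈ a.primeFactors, sigma 1 q := by
    conv_lhs => rw [← Nat.prod_primeFactors_of_squarefree ha]
    exact isMultiplicative_sigma.map_prod_of_prime _ fun q hq => Nat.prime_of_mem_primeFactors hq
  rw [h1] at h
  obtain ⟨q, hq, hrq⟩ := (hr.prime.dvd_finsetProd_iff _).1 h
  have hqp := Nat.prime_of_mem_primeFactors hq
  refine ⟨q, hqp, Nat.dvd_of_mem_primeFactors hq, ?_⟩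
  have := sigma_one_apply_prime_pow (i := 1) hqp
  simp [Finset.sum_range_succ] at this
  rw [this, add_comm] at hrq
  exact hrq

/-- Since `p + 1` is even and `a` odd, `2a ≤ p + 1`. A prime factor of `σ(a)` is at most `a + 1 <
p`, so `p ∤ σ(a)` and multiplicativity of `σ` applies. -/
lemma mul_sigma_dvd_gcd {p a : ℕ} (hp : p.Prime) (hp3 : 3 < p) (hap : a ∣ p + 1) (hodd : Odd a)
    (hsq : Squarefree a) (hco : a.Coprime (sigma 1 a)) :
    a * sigma 1 a ∣ Nat.gcd (p * (a * sigma 1 a)) (sigma 1 (p * (a * sigma 1 a))) := by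
  have hpa : p.Coprime a := by
    have : p.Coprime (p + 1) := by simp
    exact this.coprime_dvd_right hap
  have h2a : 2 * a ∣ p + 1 := by
    refine Nat.Coprime.mul_dvd_of_dvd_of_dvd (Nat.coprime_two_left.2 hodd) ?_ hap
    have := hp.odd_of_ne_two (by omega)
    exact even_iff_two_dvd.1 this.add_one
  have h2le := Nat.le_of_dvd (by omega) h2a
  have hps : p.Coprime (sigma 1 a) := by
    rw [hp.coprime_iff_not_dvd]
    intro h
    obtain ⟨q, -, hqa, hpq⟩ := exists_prime_dvd_add_one_of_dvd_sigma hsq hp h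
    have h1 := Nat.le_of_dvd hodd.pos hqa
    have h2 := Nat.le_of_dvd (by omega) hpq
    omega
  have hσp : sigma 1 p = p + 1 := by
    have := sigma_one_apply_prime_pow (i := 1) hp
    simp [Finset.sum_range_succ] at this
    omega
  refine Nat.dvd_gcd (Dvd.intro_left _ rfl) ?_
  rw [isMultiplicative_sigma.map_mul_of_coprime (hpa.mul_right hps),
    isMultiplicative_sigma.map_mul_of_coprime hco, hσp]
  exact mul_dvd_mul hap (Dvd.intro _ rfl)

/-- Every positive integer is the product of a `Y`-smooth number and a number all of whose prime
factors are at least `Y`. -/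
lemma exists_smooth_mul_rough (Y : ℕ) {n : ℕ} (hn : n ≠ 0) :
    ∃ m a, m ∈ Nat.smoothNumbers Y ∧ n = m * a ∧ ∀ q, q.Prime → q ∣ a → Y ≤ q := by
  refine ⟨(n.primeFactorsList.filter (· < Y)).prod, (n.primeFactorsList.filter fun q => !decide (q < Y)).prod,
    Nat.prod_mem_smoothNumbers n Y, ?_, ?_⟩
  · have h := (List.filter_append_perm (fun q => decide (q < Y)) n.primeFactorsList).prod_eq
    rw [List.prod_append, Nat.prod_primeFactorsList hn] at h
    exact h.symm
  · intro q hq hqa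
    obtain ⟨r, hr, hqr⟩ := (hq.prime.dvd_prod_iff).1 hqa
    rw [List.mem_filter] at hr
    have := (Nat.prime_dvd_prime_iff_eq hq (Nat.prime_of_mem_primeFactorsList hr.1)).1 hqr
    simp at hr
    omega

/-- A prime `r` dividing both `a` and `σ(a)` divides `q + 1` for some prime `q ∣ a`. Then `r` and
`q` are coprime, so `r * q ∣ n`, which `h1` forbids. -/
lemma squarefree_and_coprime_sigma {Y n a : ℕ} (han : a ∣ n)
    (hrough : ∀ q, q.Prime → q ∣ a → Y ≤ q)
    (h2 : ∀ r, Y ≤ r → ¬ r ^ 2 ∣ n)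
    (h1 : ∀ r q, Y ≤ r → q.Prime → r ∣ q + 1 → ¬ r * q ∣ n) :
    Squarefree a ∧ a.Coprime (sigma 1 a) := by
  have hsq : Squarefree a := by
    rw [Nat.squarefree_iff_prime_squarefree]
    intro r hr hra
    exact h2 r (hrough r hr (dvd_of_mul_left_dvd hra)) (by rw [sq]; exact hra.trans han)
  refine ⟨hsq, Nat.Coprime.symm <| Nat.coprime_of_dvd fun r hr hrs hra => ?_⟩
  obtain ⟨q, hq, hqa, hrq⟩ := exists_prime_dvd_add_one_of_dvd_sigma hsq hr hrs
  refine h1 r q (hrough r hr hra) hq hrq ?_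
  refine (Nat.Coprime.mul_dvd_of_dvd_of_dvd ?_ hra hqa).trans han
  have : (q + 1).Coprime q := by simp
  exact this.coprime_dvd_left hrq

/-! ### Union bounds for the exceptional integers -/

lemma card_filter_exists_dvd_le {ι : Type*} (x : ℕ) (s : Finset ι) (d : ι → ℕ) (P : ℕ → Prop)
    [DecidablePred P] (hP : ∀ n, 0 < n → n ≤ x → P n → ∃ i ∈ s, d i ∣ n) :
    ((((Finset.Ioc 0 x).filter P).card : ℕ) : ℝ) ≤ ∑ i ∈ s, (x : ℝ) / d i := by
  classical
  have hsub : (Finset.Ioc 0 x).filter P ⊆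
      s.biUnion fun i => (Finset.Ioc 0 x).filter fun n => d i ∣ n := by
    intro n hn
    simp only [Finset.mem_filter, Finset.mem_Ioc, Finset.mem_biUnion] at hn ⊢
    obtain ⟨i, hi, hd⟩ := hP n hn.1.1 hn.1.2 hn.2
    exact ⟨i, hi, hn.1, hd⟩
  calc ((((Finset.Ioc 0 x).filter P).card : ℕ) : ℝ)
      ≤ ((∑ i ∈ s, ((Finset.Ioc 0 x).filter fun n => d i ∣ n).card : ℕ) : ℝ) := by
        exact_mod_cast (Finset.card_le_card hsub).trans Finset.card_biUnion_le
    _ ≤ _ := by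
        rw [Nat.cast_sum]
        refine Finset.sum_le_sum fun i _ => ?_
        rw [Nat.Ioc_filter_dvd_card_eq_div]
        exact Nat.cast_div_le

open Classical in
lemma card_filter_sq_dvd_le (x Y : ℕ) (hY : 1 < Y) :
    ((((Finset.Ioc 0 x).filter fun n => ∃ r, Y ≤ r ∧ r ^ 2 ∣ n).card : ℕ) : ℝ) ≤ 2 * x / Y := by
  refine (card_filter_exists_dvd_le x (Finset.Ioo (Y - 1) (x + 1)) (fun r => r ^ 2) _ ?_).trans ?_
  · rintro n hn0 hnx ⟨r, hYr, hr⟩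
    refine ⟨r, ?_, hr⟩
    have := Nat.le_of_dvd hn0 hr
    rw [Finset.mem_Ioo]
    constructor
    · omega
    · nlinarith
  · have h := sum_Ioo_inv_sq_le (α := ℝ) (Y - 1) (x + 1)
    have hc : ((Y - 1 : ℕ) : ℝ) + 1 = Y := by exact_mod_cast Nat.sub_add_cancel hY.le
    rw [hc] at h
    simp only [Nat.cast_pow, div_eq_mul_inv, ← Finset.mul_sum]
    calc (x : ℝ) * _ ≤ x * (2 / Y) := by gcongr
      _ = _ := by ring

open Classical in
-- With `q + 1 = r t`, the divisor is `r (r t - 1) ≥ r ^ 2 t / 2`. Summing its reciprocal over `r ≥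
-- Y` gives a factor `1 / Y`, and over `t` a logarithm.
lemma card_filter_mul_dvd_le (x Y : ℕ) (hY : 1 < Y) :
    ((((Finset.Ioc 0 x).filter fun n =>
      ∃ r q, Y ≤ r ∧ q.Prime ∧ r ∣ q + 1 ∧ r * q ∣ n).card : ℕ) : ℝ) ≤
      4 * x / Y * (1 + Real.log (x + 1)) := by
  refine (card_filter_exists_dvd_le x (Finset.Ioo (Y - 1) (x + 1) ×ˢ Finset.Icc 1 (x + 1))
    (fun i => i.1 * (i.1 * i.2 - 1)) _ ?_).trans ?_
  · rintro n hn0 hnx ⟨r, q, hYr, hq, ⟨t, ht⟩, hd⟩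
    have hle := Nat.le_of_dvd hn0 hd
    have hq0 := hq.pos
    have hr0 : 0 < r := by omega
    have hrx : r ≤ x := by nlinarith
    have hqx : q ≤ x := by nlinarith
    have ht0 : 0 < t := Nat.pos_of_ne_zero (by rintro rfl; omega)
    have htx : t ≤ q + 1 := by nlinarith
    refine ⟨(r, t), ?_, ?_⟩
    · simp only [Finset.mem_product, Finset.mem_Ioo, Finset.mem_Icc]
      omega
    · simpa [← ht] using hd
  · have h := sum_Ioo_inv_sq_le (α := ℝ) (Y - 1) (x + 1)
    have hc : ((Y - 1 : ℕ) : ℝ) + 1 = Y := by exact_mod_cast Nat.sub_add_cancel hY.le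
    rw [hc] at h
    have hH : ∑ t ∈ Finset.Icc 1 (x + 1), (t : ℝ)⁻¹ ≤ 1 + Real.log (x + 1) := by
      have := harmonic_le_one_add_log (x + 1)
      rw [harmonic_eq_sum_Icc] at this
      push_cast at this
      exact this
    calc ∑ i ∈ Finset.Ioo (Y - 1) (x + 1) ×ˢ Finset.Icc 1 (x + 1),
          (x : ℝ) / ((i.1 * (i.1 * i.2 - 1) : ℕ) : ℝ)
        ≤ ∑ i ∈ Finset.Ioo (Y - 1) (x + 1) ×ˢ Finset.Icc 1 (x + 1),
          2 * x * (((i.1 : ℝ) ^ 2)⁻¹ * (i.2 : ℝ)⁻¹) := by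
          refine Finset.sum_le_sum fun i hi => ?_
          simp only [Finset.mem_product, Finset.mem_Ioo, Finset.mem_Icc] at hi
          have h1 : 2 ≤ i.1 := by omega
          have h2 : 1 ≤ i.2 := by omega
          have h3 : 2 ≤ i.1 * i.2 := by nlinarith
          have h1' : (2 : ℝ) ≤ i.1 := by exact_mod_cast h1
          have h2' : (1 : ℝ) ≤ i.2 := by exact_mod_cast h2
          have h3' : (2 : ℝ) ≤ i.1 * i.2 := by exact_mod_cast h3
          rw [Nat.cast_mul, Nat.cast_sub (by omega)]
          push_cast
          rw [← mul_inv, ← div_eq_mul_inv, div_le_div_iff₀ (by nlinarith) (by positivity)]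
          have : (i.1 : ℝ) ^ 2 * i.2 ≤ 2 * (i.1 * (i.1 * i.2 - 1)) := by nlinarith
          calc (x : ℝ) * (i.1 ^ 2 * i.2) ≤ x * (2 * (i.1 * (i.1 * i.2 - 1))) := by gcongr
            _ = _ := by ring
      _ = 2 * x * ((∑ r ∈ Finset.Ioo (Y - 1) (x + 1), ((r : ℝ) ^ 2)⁻¹) *
          ∑ t ∈ Finset.Icc 1 (x + 1), (t : ℝ)⁻¹) := by
          rw [← Finset.mul_sum, Finset.sum_mul_sum, Finset.sum_product]
      _ ≤ 2 * x * (2 / Y * (1 + Real.log (x + 1))) := by gcongr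
      _ = _ := by ring

/-! ### Smooth numbers by Rankin's method -/

lemma sum_primesBelow_rpow_le (Y : ℕ) :
    ∑ p ∈ Nat.primesBelow Y, (p : ℝ) ^ (-(3 / 4) : ℝ) ≤ 4 * (Y : ℝ) ^ (1 / 4 : ℝ) := by
  have key : ∀ n : ℕ, ∑ i ∈ Finset.Icc 1 n, (i : ℝ) ^ (-(3 / 4) : ℝ) ≤
      4 * (n : ℝ) ^ (1 / 4 : ℝ) := by
    intro n
    induction n with
    | zero => simp
    | succ n ih =>
      rw [Finset.sum_Icc_succ_top (by omega)]
      -- Bernoulli for the concave power: `(1 - 1/b) ^ (1/4) ≤ 1 - 1/(4b)` with `b = n + 1`.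
      have h : (n : ℝ) ^ (1 / 4 : ℝ) + ((n + 1 : ℕ) : ℝ) ^ (-(3 / 4) : ℝ) / 4 ≤
          ((n + 1 : ℕ) : ℝ) ^ (1 / 4 : ℝ) := by
        push_cast
        have hb : (0 : ℝ) < n + 1 := by positivity
        set b : ℝ := (n + 1 : ℝ) with hbdef
        have hn : (n : ℝ) = b * (1 + (-(1 / b))) := by
          field_simp
          simp [hbdef]
        have hb1 : 1 / b ≤ 1 := by
          rw [div_le_one hb, hbdef]; simp
        have hB := rpow_one_add_le_one_add_mul_self (s := -(1 / b)) (by linarith)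
          (p := 1 / 4) (by norm_num) (by norm_num)
        rw [hn, Real.mul_rpow hb.le (by linarith)]
        have h2 : b ^ (-(3 / 4) : ℝ) = b ^ (1 / 4 : ℝ) * (1 / b) := by
          rw [show (-(3 / 4) : ℝ) = 1 / 4 + -1 by norm_num, Real.rpow_add hb, Real.rpow_neg_one,
            one_div b]
        rw [h2]
        have := mul_le_mul_of_nonneg_left hB (Real.rpow_nonneg hb.le (1 / 4 : ℝ))
        nlinarith
      linarith
  refine le_trans (Finset.sum_le_sum_of_subset_of_nonneg ?_ fun i _ _ => by positivity) (key Y)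
  intro p hp
  have h1 := Nat.lt_of_mem_primesBelow hp
  have h2 := (Nat.prime_of_mem_primesBelow hp).pos
  simp only [Finset.mem_Icc]
  omega

/-- The value `2/3` is the threshold up to which `1 / (1 - t) ≤ 1 + 3t`, used for the Euler factors.
-/
lemma prime_rpow_le {p : ℕ} (hp : p.Prime) : (p : ℝ) ^ (-(3 / 4) : ℝ) ≤ 2 / 3 := by
  have h2 : (2 : ℝ) ≤ p := by exact_mod_cast hp.two_le
  calc (p : ℝ) ^ (-(3 / 4) : ℝ) ≤ (2 : ℝ) ^ (-(3 / 4) : ℝ) :=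
        Real.rpow_le_rpow_of_nonpos (by norm_num) h2 (by norm_num)
    _ ≤ 2 / 3 := by
        rw [← pow_le_pow_iff_left₀ (by positivity) (by norm_num) (n := 4) (by norm_num),
          ← Real.rpow_mul_natCast (by norm_num)]
        norm_num

lemma prod_primesBelow_inv_le (Y : ℕ) :
    ∏ p ∈ Nat.primesBelow Y, (1 - (p : ℝ) ^ (-(3 / 4) : ℝ))⁻¹ ≤
      Real.exp (12 * (Y : ℝ) ^ (1 / 4 : ℝ)) := by
  calc ∏ p ∈ Nat.primesBelow Y, (1 - (p : ℝ) ^ (-(3 / 4) : ℝ))⁻¹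
      ≤ ∏ p ∈ Nat.primesBelow Y, Real.exp (3 * (p : ℝ) ^ (-(3 / 4) : ℝ)) := by
        refine Finset.prod_le_prod (fun p hp => ?_) fun p hp => ?_
        · have := prime_rpow_le (Nat.prime_of_mem_primesBelow hp)
          exact inv_nonneg.2 (by linarith)
        · have h := prime_rpow_le (Nat.prime_of_mem_primesBelow hp)
          have h0 : 0 ≤ (p : ℝ) ^ (-(3 / 4) : ℝ) := by positivity
          set t := (p : ℝ) ^ (-(3 / 4) : ℝ)
          refine le_trans ?_ (Real.add_one_le_exp _)
          rw [inv_le_iff_one_le_mul₀ (by linarith)]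
          nlinarith
    _ = Real.exp (3 * ∑ p ∈ Nat.primesBelow Y, (p : ℝ) ^ (-(3 / 4) : ℝ)) := by
        rw [← Real.exp_sum, Finset.mul_sum]
    _ ≤ _ := by
        have := sum_primesBelow_rpow_le Y
        exact Real.exp_le_exp.2 (by linarith)

/-- The completely multiplicative function `n ↦ n ^ s` for real `s`. -/
noncomputable def natRpowHom (s : ℝ) : ℕ →* ℝ where
  toFun n := (n : ℝ) ^ s
  map_one' := by simp
  map_mul' m n := by
    push_cast
    exact Real.mul_rpow (Nat.cast_nonneg _) (Nat.cast_nonneg _)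

/-- The full sum over `Y`-smooth numbers is the Euler product over primes below `Y`. -/
lemma sum_smooth_rpow_le (Y : ℕ) (s : Finset ℕ) (hs : ∀ m ∈ s, m ∈ Nat.smoothNumbers Y) :
    ∑ m ∈ s, (m : ℝ) ^ (-(3 / 4) : ℝ) ≤ Real.exp (12 * (Y : ℝ) ^ (1 / 4 : ℝ)) := by
  have h := (EulerProduct.summable_and_hasSum_smoothNumbers_prod_primesBelow_geometric
    (f := natRpowHom (-(3 / 4))) (fun {p} hp => by
      have := prime_rpow_le hp
      change ‖(p : ℝ) ^ (-(3 / 4) : ℝ)‖ < 1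
      rw [Real.norm_of_nonneg (by positivity)]
      linarith) Y).2
  refine le_trans ?_ (prod_primesBelow_inv_le Y)
  have h2 := sum_le_hasSum (s.subtype (· ∈ Nat.smoothNumbers Y))
    (fun i _ => Real.rpow_nonneg (Nat.cast_nonneg _) _) h
  exact (Finset.sum_subtype_of_mem (fun m : ℕ => (m : ℝ) ^ (-(3 / 4) : ℝ)) hs).symm.trans_le h2

open Classical in
/-- Rankin's bound for the number of `n ≤ x` with a large smooth divisor. -/
lemma card_filter_smooth_dvd_le (x Y : ℕ) {z : ℝ} (hz : 0 < z) :
    ((((Finset.Ioc 0 x).filter fun n =>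
      ∃ m ∈ Nat.smoothNumbers Y, z ≤ m ∧ m ∣ n).card : ℕ) : ℝ) ≤
      x * (z ^ (-(1 / 4) : ℝ) * Real.exp (12 * (Y : ℝ) ^ (1 / 4 : ℝ))) := by
  set s := (Finset.Ioc 0 x).filter fun m => m ∈ Nat.smoothNumbers Y ∧ z ≤ m with hs
  refine (card_filter_exists_dvd_le x s id _ ?_).trans ?_
  · rintro n hn0 hnx ⟨m, hm, hzm, hd⟩
    refine ⟨m, ?_, hd⟩
    have := Nat.le_of_dvd hn0 hd
    simp only [hs, Finset.mem_filter, Finset.mem_Ioc]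
    exact ⟨⟨Nat.pos_of_dvd_of_pos hd hn0, this.trans hnx⟩, hm, hzm⟩
  · calc ∑ m ∈ s, (x : ℝ) / (id m : ℕ)
        ≤ ∑ m ∈ s, x * (z ^ (-(1 / 4) : ℝ) * (m : ℝ) ^ (-(3 / 4) : ℝ)) := by
          refine Finset.sum_le_sum fun m hm => ?_
          simp only [hs, Finset.mem_filter, Finset.mem_Ioc] at hm
          have hm0 : (0 : ℝ) < m := by exact_mod_cast hm.1.1
          -- Rankin's trick: a quarter power of `1 / m` is traded for the saving `z ^ (-1/4)`.
          have h1 : (m : ℝ) ^ (-(1 / 4) : ℝ) ≤ z ^ (-(1 / 4) : ℝ) :=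
            Real.rpow_le_rpow_of_nonpos hz hm.2.2 (by norm_num)
          have h2 : (m : ℝ)⁻¹ = (m : ℝ) ^ (-(1 / 4) : ℝ) * (m : ℝ) ^ (-(3 / 4) : ℝ) := by
            rw [← Real.rpow_add hm0, ← Real.rpow_neg_one]
            norm_num
          rw [id, div_eq_mul_inv, h2]
          gcongr
      _ = x * (z ^ (-(1 / 4) : ℝ) * ∑ m ∈ s, (m : ℝ) ^ (-(3 / 4) : ℝ)) := by
          rw [← Finset.mul_sum, ← Finset.mul_sum]
      _ ≤ _ := by
          gcongr
          exact sum_smooth_rpow_le Y s fun m hm => by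
            simp only [hs, Finset.mem_filter] at hm
            exact hm.2.1

/-! ### Primes `p` with a large good divisor of `p + 1` -/

lemma eventually_mul_exp_rpow_le (A C : ℝ) {c : ℝ} (hA : 0 < A) (hc : 0 < c) :
    ∀ᶠ k : ℕ in Filter.atTop,
      A * k * Real.exp (C * (k : ℝ) ^ (3 / 4 : ℝ)) ≤ Real.exp (c * k) := by
  have h1 : (fun x : ℝ => Real.log A) =o[Filter.atTop] (fun x : ℝ => x) :=
    Asymptotics.isLittleO_const_id_atTop _
  have h2 : Real.log =o[Filter.atTop] (fun x : ℝ => x) := Real.isLittleO_log_id_atTop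
  have h3 : (fun x : ℝ => C * x ^ (3 / 4 : ℝ)) =o[Filter.atTop] (fun x : ℝ => x) := by
    have : (fun x : ℝ => x ^ (3 / 4 : ℝ)) =o[Filter.atTop] (fun x : ℝ => x) := by
      rw [Asymptotics.isLittleO_iff_tendsto' ((Filter.eventually_gt_atTop 0).mono
        fun x hx h => absurd h hx.ne')]
      refine (tendsto_rpow_neg_atTop (y := 1 / 4) (by norm_num)).congr' ?_
      filter_upwards [Filter.eventually_gt_atTop 0] with x hx
      rw [show (-(1 / 4) : ℝ) = 3 / 4 - 1 by norm_num, Real.rpow_sub_one hx.ne']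
    exact this.const_mul_left C
  have h4 := ((h1.add h2).add h3).bound hc
  filter_upwards [tendsto_natCast_atTop_atTop.eventually h4, Filter.eventually_gt_atTop 0]
    with k hk hk0
  have hk0' : (0 : ℝ) < k := by exact_mod_cast hk0
  rw [Real.norm_of_nonneg hk0'.le] at hk
  calc A * k * Real.exp (C * (k : ℝ) ^ (3 / 4 : ℝ))
      = Real.exp (Real.log A + Real.log k + C * (k : ℝ) ^ (3 / 4 : ℝ)) := by
        rw [Real.exp_add, Real.exp_add, Real.exp_log hA, Real.exp_log hk0']
    _ ≤ _ := Real.exp_le_exp.2 ((le_abs_self _).trans hk)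

lemma two_pow_sub_le_mul_primeCounting {k : ℕ} (hk : 0 < k) :
    (2 : ℝ) ^ k - (k + 1) ≤ k * Nat.primeCounting (2 ^ k) := by
  have h := Chebyshev.pi_ge (2 ^ k)
  have hl : (0 : ℝ) < Real.log 2 := Real.log_pos (by norm_num)
  have hk' : (0 : ℝ) < k := by exact_mod_cast hk
  push_cast at h
  rw [Real.log_pow, div_le_iff₀ (by positivity)] at h
  have h2 : Real.log ((2 : ℝ) ^ k + 1) ≤ (k + 1) * Real.log 2 := by
    rw [← Nat.cast_succ, ← Real.log_pow]
    refine Real.log_le_log (by positivity) ?_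
    rw [pow_succ]
    have : (1 : ℝ) ≤ 2 ^ k := one_le_pow₀ (by norm_num)
    linarith
  refine le_of_mul_le_mul_right ?_ hl
  nlinarith

lemma exists_prime_and_large_divisor {δ : ℝ} (hδ : 0 < δ) :
    ∀ᶠ k : ℕ in Filter.atTop, ∃ p a : ℕ, p.Prime ∧ p ≤ 2 ^ k ∧
      Real.exp (Real.log 2 / 2 * k) < p ∧ a ∣ p + 1 ∧ Odd a ∧ Squarefree a ∧
      a.Coprime (sigma 1 a) ∧ (p + 1 : ℝ) < a * Real.exp (δ * k) := by
  classical
  have hl : (0 : ℝ) < Real.log 2 := Real.log_pos (by norm_num)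
  filter_upwards [eventually_mul_exp_rpow_le 20 0 (c := Real.log 2 / 2)
      (by norm_num) (by positivity),
    eventually_mul_exp_rpow_le 20 (12 * (1000 : ℝ) ^ (1 / 4 : ℝ)) (c := δ / 4)
      (by norm_num) (by positivity), Filter.eventually_gt_atTop 0] with k hk1 hk2 hk0
  have hk' : (1 : ℝ) ≤ k := by exact_mod_cast hk0
  by_contra! hcon
  set w : ℝ := Real.exp (Real.log 2 / 2 * k) with hw
  set X : ℕ := 2 ^ k with hX
  have hXR : (X : ℝ) = 2 ^ k := by simp [hX]
  have hww : w * w = X := by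
    rw [hw, ← Real.exp_add, hXR, show Real.log 2 / 2 * k + Real.log 2 / 2 * k = k * Real.log 2 by ring,
      ← Real.log_pow, Real.exp_log (by positivity)]
  have hw0 : 0 < w := Real.exp_pos _
  have hX1 : 1 ≤ X := Nat.one_le_two_pow
  have hX1' : (1 : ℝ) ≤ X := by exact_mod_cast hX1
  -- The bound for `B1`, of order `X k / Y`, must beat `X / k`, while Rankin needs `Y ^ (1/4) =
  -- o(k)`; the cube of `k` meets both.
  set Y : ℕ := 1000 * k ^ 3 with hY
  have hY1 : 2 < Y := by
    have : 1 ≤ k ^ 3 := Nat.one_le_pow _ _ hk0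
    omega
  have hYR : (Y : ℝ) = 1000 * k ^ 3 := by simp [hY]
  have b1 := card_filter_mul_dvd_le (2 * X) Y (by omega)
  have b2 := card_filter_sq_dvd_le (2 * X) Y (by omega)
  have b3 := card_filter_smooth_dvd_le (2 * X) Y (Real.exp_pos (δ * k))
  set B1 := (Finset.Ioc 0 (2 * X)).filter fun n =>
      ∃ r q, Y ≤ r ∧ q.Prime ∧ r ∣ q + 1 ∧ r * q ∣ n with hB1
  set B2 := (Finset.Ioc 0 (2 * X)).filter fun n => ∃ r, Y ≤ r ∧ r ^ 2 ∣ n with hB2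
  set B3 := (Finset.Ioc 0 (2 * X)).filter fun n =>
      ∃ m ∈ Nat.smoothNumbers Y, Real.exp (δ * k) ≤ m ∧ m ∣ n with hB3
  -- Primes up to `w = √X` are discarded trivially; for any other prime, `p + 1` must be
  -- exceptional, as otherwise its rough part contradicts `hcon`.
  have hsub : Nat.primesLE X ⊆ Finset.Ioc 0 ⌊w⌋₊ ∪ (B1 ∪ (B2 ∪ B3)).image (· - 1) := by
    intro p hp
    have hpp := Nat.prime_of_mem_primesLE hp
    have hpX : p ≤ X := Nat.le_of_mem_primesLE hp
    by_contra hnot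
    simp only [Finset.mem_union, Finset.mem_image, not_or, not_exists, not_and] at hnot
    obtain ⟨hn1, hn2⟩ := hnot
    have hpw : w < p := by
      by_contra! h
      exact hn1 (Finset.mem_Ioc.2 ⟨hpp.pos, Nat.le_floor h⟩)
    have hmem : p + 1 ∈ Finset.Ioc 0 (2 * X) := by
      rw [Finset.mem_Ioc]; omega
    have hn3 : p + 1 ∉ B1 ∧ p + 1 ∉ B2 ∧ p + 1 ∉ B3 := by
      refine ⟨fun h => hn2 (p + 1) (Or.inl h) rfl, fun h => hn2 (p + 1) (Or.inr (Or.inl h)) rfl,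
        fun h => hn2 (p + 1) (Or.inr (Or.inr h)) rfl⟩
    simp only [hB1, hB2, hB3, Finset.mem_filter, hmem, true_and] at hn3
    obtain ⟨g1, g2, g3⟩ := hn3
    push Not at g1 g2 g3
    obtain ⟨m, a, hm, hma, hrough⟩ := exists_smooth_mul_rough Y (n := p + 1) (by omega)
    have had : a ∣ p + 1 := hma ▸ Dvd.intro_left _ rfl
    obtain ⟨hsq, hco⟩ := squarefree_and_coprime_sigma had hrough g2 g1
    have hodd : Odd a := by
      rw [← Nat.not_even_iff_odd, even_iff_two_dvd]
      intro h
      have := hrough 2 Nat.prime_two h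
      omega
    have hml : (m : ℝ) < Real.exp (δ * k) := by
      by_contra! h
      exact g3 m hm h (hma ▸ Dvd.intro _ rfl)
    have h := hcon p a hpp hpX hpw had hodd hsq hco
    have ha0 : (0 : ℝ) < a := by exact_mod_cast hodd.pos
    have hR : (p + 1 : ℝ) = m * a := by exact_mod_cast hma
    nlinarith
  have hcard : (Nat.primeCounting X : ℝ) ≤ w + (B1.card + (B2.card + B3.card)) := by
    rw [← Nat.primesLE_card_eq_primeCounting]
    have h1 : (Nat.primesLE X).card ≤ ⌊w⌋₊ + (B1.card + (B2.card + B3.card)) := by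
      refine (Finset.card_le_card hsub).trans ((Finset.card_union_le _ _).trans ?_)
      refine Nat.add_le_add (by simp) (Finset.card_image_le.trans ?_)
      exact (Finset.card_union_le _ _).trans
        (Nat.add_le_add_left (Finset.card_union_le _ _) _)
    have h2 : ((Nat.primesLE X).card : ℝ) ≤ ⌊w⌋₊ + (B1.card + (B2.card + B3.card)) := by
      exact_mod_cast h1
    linarith [Nat.floor_le hw0.le]
  have hpi := two_pow_sub_le_mul_primeCounting hk0
  rw [← hX, ← hXR] at hpi
  simp only [zero_mul, Real.exp_zero, mul_one] at hk1
  have hkX : 20 * k * w ≤ X := by rw [← hww]; gcongr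
  have hw1 : 20 ≤ w := by nlinarith
  have e1 : k * (B1.card : ℝ) ≤ X / 20 := by
    have hlog : Real.log (((2 * X : ℕ) : ℝ) + 1) ≤ k + 2 := by
      have h1 : Real.log (((2 * X : ℕ) : ℝ) + 1) ≤ Real.log ((2 : ℝ) ^ (k + 2)) := by
        refine Real.log_le_log (by positivity) ?_
        push_cast
        rw [pow_add, ← hXR]
        linarith
      rw [Real.log_pow] at h1
      refine h1.trans ?_
      push_cast
      exact mul_le_of_le_one_right (by positivity) (by linarith [Real.log_two_lt_d9])
    have h2 : (B1.card : ℝ) ≤ 4 * (2 * X) / (1000 * k ^ 3) * (1 + (k + 2)) := by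
      refine b1.trans ?_
      rw [hYR]
      push_cast at hlog ⊢
      gcongr
    calc k * (B1.card : ℝ) ≤ k * (4 * (2 * X) / (1000 * k ^ 3) * (1 + (k + 2))) := by gcongr
      _ = X * (8 * (k + 3) / (1000 * k ^ 2)) := by field_simp; ring
      _ ≤ X * (1 / 20) := by
        refine mul_le_mul_of_nonneg_left ?_ (by positivity)
        rw [div_le_iff₀ (by positivity)]
        nlinarith
      _ = _ := by ring
  have e2 : k * (B2.card : ℝ) ≤ X / 20 := by
    calc k * (B2.card : ℝ) ≤ k * (2 * (2 * X) / (1000 * k ^ 3)) := by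
          rw [hYR] at b2
          push_cast at b2
          gcongr
      _ = X * (4 / (1000 * k ^ 2)) := by field_simp; ring
      _ ≤ X * (1 / 20) := by
        refine mul_le_mul_of_nonneg_left ?_ (by positivity)
        rw [div_le_iff₀ (by positivity)]
        nlinarith
      _ = _ := by ring
  have e3 : k * (B3.card : ℝ) ≤ X / 10 := by
    have hYq : (Y : ℝ) ^ (1 / 4 : ℝ) = (1000 : ℝ) ^ (1 / 4 : ℝ) * (k : ℝ) ^ (3 / 4 : ℝ) := by
      rw [hYR, Real.mul_rpow (by norm_num) (by positivity), ← Real.rpow_natCast,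
        ← Real.rpow_mul (by positivity)]
      norm_num
    rw [hYq, ← Real.exp_mul, ← mul_assoc 12] at b3
    have h0 : Real.exp (δ * k * -(1 / 4)) * Real.exp (δ / 4 * k) = 1 := by
      rw [← Real.exp_add, Real.exp_eq_one_iff]
      ring
    set E := Real.exp (12 * (1000 : ℝ) ^ (1 / 4 : ℝ) * (k : ℝ) ^ (3 / 4 : ℝ))
    set F := Real.exp (δ * k * -(1 / 4))
    have hF : 0 < F := Real.exp_pos _
    push_cast at b3
    have h1 : 20 * k * E * F ≤ 1 := by
      rw [← h0, mul_comm F]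
      gcongr
    calc k * (B3.card : ℝ) ≤ k * (2 * X * (F * E)) := by gcongr
      _ = X / 10 * (20 * k * E * F) := by ring
      _ ≤ X / 10 * 1 := by gcongr
      _ = _ := by ring
  have hfin : k * (Nat.primeCounting X : ℝ) ≤ k * (w + (B1.card + (B2.card + B3.card))) := by
    gcongr
  -- The losses total `X/20 + X/20 + X/20 + X/10 = X/4`, whereas `k π(X) ≥ X - (k + 1)` and `X ≥ 400
  -- k`.
  nlinarith

/-! ### Exponents and conclusion -/

/-- Cancelling `D ^ (2/3 - ε)` leaves `p ^ (2/3 - ε) ≤ D ^ (1/3 + ε)`, which follows from `2 (1 - ε)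
(1/3 + ε) ≥ 2/3 - ε`, valid for `0 < ε ≤ 1`. -/
lemma rpow_le_of_sq_le {p D ε : ℝ} (hp : 1 ≤ p) (hε : 0 < ε) (hε1 : ε ≤ 1)
    (hD : (p ^ (1 - ε)) ^ 2 ≤ D) : (p * D) ^ ((2 : ℝ) / 3 - ε) ≤ D := by
  have hp0 : 0 < p := by linarith
  have hD0 : 0 < D := lt_of_lt_of_le (by positivity) hD
  rw [Real.mul_rpow hp0.le hD0.le]
  have h1 : p ^ ((2 : ℝ) / 3 - ε) ≤ D ^ ((1 : ℝ) / 3 + ε) := by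
    calc p ^ ((2 : ℝ) / 3 - ε) ≤ p ^ ((1 - ε) * 2 * (1 / 3 + ε)) :=
          Real.rpow_le_rpow_of_exponent_le hp (by nlinarith)
      _ = ((p ^ (1 - ε)) ^ 2) ^ ((1 : ℝ) / 3 + ε) := by
          rw [← Real.rpow_mul_natCast hp0.le, ← Real.rpow_mul hp0.le]
          norm_num
      _ ≤ _ := Real.rpow_le_rpow (by positivity) hD (by linarith)
  calc p ^ ((2 : ℝ) / 3 - ε) * D ^ ((2 : ℝ) / 3 - ε)
      ≤ D ^ ((1 : ℝ) / 3 + ε) * D ^ ((2 : ℝ) / 3 - ε) := by gcongr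
    _ = D := by
        rw [← Real.rpow_add hD0]
        norm_num

theorem theorem1p4 (ε : ℝ) (hε : 0 < ε) :
    {N : ℕ | 0 < N ∧
      (N : ℝ) ^ ((2 : ℝ) / 3 - ε) ≤ (Nat.gcd N (ArithmeticFunction.sigma 1 N) : ℝ)}.Infinite := by
  have hl : (0 : ℝ) < Real.log 2 := Real.log_pos (by norm_num)
  -- Since `N ≥ 1`, the bound for a smaller `ε` is stronger, so `ε` may be capped at `1`.
  set η := min ε 1 with hη
  have hη0 : 0 < η := lt_min hε one_pos
  have hη1 : η ≤ 1 := min_le_right _ _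
  have hηε : η ≤ ε := min_le_left _ _
  refine Set.infinite_of_forall_exists_gt fun n => ?_
  have hlarge : ∀ᶠ k : ℕ in Filter.atTop, (n + 3 : ℝ) ≤ Real.exp (Real.log 2 / 2 * k) :=
    (Real.tendsto_exp_atTop.comp
      (tendsto_natCast_atTop_atTop.const_mul_atTop (by positivity))).eventually_ge_atTop _
  -- This `δ` makes `exp (δ k) = (√X) ^ η < p ^ η`, whence `a ≥ p ^ (1 - η)`.
  obtain ⟨k, ⟨p, a, hp, -, hpw, hap, hodd, hsq, hco, hlt⟩, hk⟩ :=
    ((exists_prime_and_large_divisor (δ := η * (Real.log 2 / 2)) (by positivity)).and hlarge).exists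
  have hpn : n + 3 < p := by exact_mod_cast hk.trans_lt hpw
  set D := a * sigma 1 a with hD
  have hdvd : D ∣ Nat.gcd (p * D) (sigma 1 (p * D)) :=
    mul_sigma_dvd_gcd hp (by omega) hap hodd hsq hco
  have hσa : a ≤ sigma 1 a := by
    rw [sigma_one_apply]
    exact Finset.single_le_sum (f := fun d => d) (fun _ _ => Nat.zero_le _)
      (Nat.mem_divisors_self a hodd.pos.ne')
  have hD0 : 0 < D := Nat.mul_pos hodd.pos (hodd.pos.trans_le hσa)
  have hN0 : 0 < p * D := Nat.mul_pos hp.pos hD0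
  refine ⟨p * D, ⟨hN0, ?_⟩, by nlinarith⟩
  have hp0 : (0 : ℝ) < p := by exact_mod_cast hp.pos
  have ha0 : (0 : ℝ) < a := by exact_mod_cast hodd.pos
  have hpa : (p : ℝ) ^ (1 - η) ≤ a := by
    have h1 : Real.exp (η * (Real.log 2 / 2) * k) ≤ (p : ℝ) ^ η := by
      rw [show η * (Real.log 2 / 2) * k = Real.log 2 / 2 * k * η by ring, Real.exp_mul]
      exact Real.rpow_le_rpow (Real.exp_pos _).le hpw.le hη0.le
    have h2 : (p : ℝ) ≤ a * (p : ℝ) ^ η := by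
      have := mul_le_mul_of_nonneg_left h1 ha0.le
      linarith
    rw [Real.rpow_sub hp0, Real.rpow_one, div_le_iff₀ (by positivity)]
    exact h2
  have hDa : ((p : ℝ) ^ (1 - η)) ^ 2 ≤ (D : ℝ) := by
    have h1 : (a : ℝ) ≤ (sigma 1 a : ℕ) := by exact_mod_cast hσa
    rw [hD, Nat.cast_mul, sq]
    have : (0 : ℝ) ≤ (p : ℝ) ^ (1 - η) := by positivity
    gcongr
    exact hpa.trans h1
  calc ((p * D : ℕ) : ℝ) ^ ((2 : ℝ) / 3 - ε) ≤ ((p * D : ℕ) : ℝ) ^ ((2 : ℝ) / 3 - η) :=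
        Real.rpow_le_rpow_of_exponent_le (by exact_mod_cast hN0) (by linarith)
    _ ≤ D := by
        rw [Nat.cast_mul]
        exact rpow_le_of_sq_le (by exact_mod_cast hp.one_le) hη0 hη1 hDa
    _ ≤ _ := by
        exact_mod_cast Nat.le_of_dvd (Nat.gcd_pos_of_pos_left _ hN0) hdvd
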